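/- Let $\mathcal H$ be a complex Hilbert space of arbitrary (possibly infinite) dimension, let $P$ be a POVM element on $\mathcal H$ (a bounded operator with $0\le P\le 1$), let $\Pi$ be an orthogonal projection and $\bar\Pi=1-\Pi$ its complement. Write $$P=\begin{pmatrix}\Pi P\Pi&\Pi P\bar\Pi\\ \bar\Pi P\Pi&\bar\Pi P\bar\Pi\end{pmatrix}\equiv\begin{pmatrix}A&B\\B^\dagger&D\end{pmatrix},\qquad H=\begin{pmatrix}0&B\\B^\dagger&0\end{pmatrix}=B+B^\dagger .$$ Let $\rho$ be a state (a positive trace-class operator with $\mathrm{Tr}\,\rho=1$), let $$\rho^{\Pi}=\frac{\Pi\rho\Pi}{\mathrm{Tr}(\rho\Pi)},\qquad \rho^{\bar\Pi}=\frac{\bar\Pi\rho\bar\Pi}{\mathrm{Tr}(\rho\bar\Pi)}$$ be its normalized diagonal blocks (read as $0$ when the denominator is $0$), and let $r=\mathrm{Tr}(\rho^{\Pi}P)$, $s=\mathrm{Tr}(\rho^{\bar\Pi}P)$. Let $W$ be a real number with $W\ge\mathrm{Tr}(\rho\bar\Pi)$. For a bounded self-adjoint operator $T$ let $T^g$ denote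 its generalized inverse: the (possibly unbounded) operator with domain $\mathrm{ran}\,T\oplus\ker T$ that inverts $T$ on its support $(\ker T)^\perp$ and vanishes on $\ker T$, so that $T^gT$ is the projection onto the support of $T$. Then $\sqrt A^{\,g}B\sqrt D^{\,g}$, on its natural domain, is densely defined and bounded, $\sqrt\rho\,H\sqrt\rho$ is trace class, and $$\big\|\sqrt\rho\,H\sqrt\rho\big\|_1\le (r+s)\,\sqrt W\,\big\|\sqrt A^{\,g}B\sqrt D^{\,g}\big\|_\infty ,$$ where $\|\cdot\|_1$ is the trace norm and $\|\cdot\|_\infty$ the spectral (operator) norm (of the bounded extension to $\mathcal H$). -/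

import Mathlib

open scoped ENNReal InnerProductSpace

noncomputable section

namespace QTrace

variable {H : Type*} [NormedAddCommGroup H] [InnerProductSpace ℂ H] [CompleteSpace H]

/-! ### Trace, trace norm, states and measurement operators -/

/-- The index set of a fixed orthonormal (Hilbert) basis of `H`. -/
def basisIndex (H : Type*) [NormedAddCommGroup H] [InnerProductSpace ℂ H] [CompleteSpace H] :
    Set H :=
  (exists_hilbertBasis ℂ H).choose

/-- A fixed orthonormal (Hilbert) basis of `H`. -/
def stdBasis (H : Type*) [NormedAddCommGroup H] [InnerProductSpace ℂ H] [CompleteSpace H] :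
    HilbertBasis (basisIndex H) ℂ H :=
  (exists_hilbertBasis ℂ H).choose_spec.choose

/-- The trace `∑ᵢ ⟨eᵢ, T eᵢ⟩ ∈ [0, ∞]` of a positive bounded operator `T`. It does not depend on
the orthonormal basis, see `posTrace_eq`. -/
def posTrace (T : H →L[ℂ] H) : ℝ≥0∞ :=
  ∑' i, ENNReal.ofReal (⟪stdBasis H i, T (stdBasis H i)⟫_ℂ).re

/-- The trace norm (Schatten `1`-norm) `‖T‖₁ = Tr |T| ∈ [0, ∞]`, where `|T| = √(T* T)`. -/
def traceNorm (T : H →L[ℂ] H) : ℝ≥0∞ :=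
  posTrace (CFC.abs T)

/-- `T` is a trace-class operator. -/
def IsTraceClass (T : H →L[ℂ] H) : Prop :=
  traceNorm T < ⊤

/-- The trace `∑ᵢ ⟨eᵢ, T eᵢ⟩` of a trace-class operator `T`. -/
def trace (T : H →L[ℂ] H) : ℂ :=
  ∑' i, ⟪stdBasis H i, T (stdBasis H i)⟫_ℂ

/-- A (normalized) state, or density operator: a positive trace-class operator of trace one. -/
structure IsState (ρ : H →L[ℂ] H) : Prop where
  nonneg : 0 ≤ ρ
  isTraceClass : IsTraceClass ρ
  trace_eq_one : trace ρ = 1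

/-- An element of a positive operator-valued measure: an operator with `0 ≤ P ≤ 1`
(equivalently, `{P, 1 - P}` is a two-outcome measurement). -/
structure IsPOVMElement (P : H →L[ℂ] H) : Prop where
  nonneg : 0 ≤ P
  le_one : P ≤ 1

/-! ### Partially defined operators and the generalized inverse -/

/-- The composition `g ∘ f` of partially defined operators on its natural domain
`{x ∈ dom f | f x ∈ dom g}`. -/
def pcomp (g f : H →ₗ.[ℂ] H) : H →ₗ.[ℂ] H where
  domain := (g.domain.comap f.toFun).map f.domain.subtype
  toFun :=
    { toFun := fun x => g ⟨f ⟨x, by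
          obtain ⟨y, _, hyx⟩ := x.2
          rw [← hyx]; exact y.2⟩, by
        obtain ⟨_, y, hy, rfl⟩ := x
        exact hy⟩
      map_add' := fun x y => by
        rw [← g.map_add]
        congr 1
        apply Subtype.ext
        exact f.map_add ⟨x, by obtain ⟨_, y, _, rfl⟩ := x; exact y.2⟩
          ⟨y, by obtain ⟨_, y, _, rfl⟩ := y; exact y.2⟩
      map_smul' := fun c x => by
        rw [RingHom.id_apply, ← g.map_smul]
        congr 1
        apply Subtype.ext
        exact f.map_smul c ⟨x, by obtain ⟨_, y, _, rfl⟩ := x; exact y.2⟩ }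

/-- The graph of the generalized inverse of `T`: the pairs `(y, x)` such that `x` lies in the
support `(ker T)ᗮ` and `y - T x` is orthogonal to the range of `T`. -/
def genInverseGraph (T : H →L[ℂ] H) : Submodule ℂ (H × H) where
  carrier := {p | p.2 ∈ (T.ker)ᗮ ∧ p.1 - T p.2 ∈ (T.range)ᗮ}
  zero_mem' := by simp
  add_mem' := by
    rintro ⟨a, b⟩ ⟨c, d⟩ ⟨h1, h2⟩ ⟨h3, h4⟩
    refine ⟨add_mem h1 h3, ?_⟩
    have := add_mem h2 h4
    simp only [Prod.mk_add_mk, map_add] at *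
    convert! this using 1
    abel
  smul_mem' := by
    rintro c ⟨a, b⟩ ⟨h1, h2⟩
    refine ⟨Submodule.smul_mem _ c h1, ?_⟩
    have := Submodule.smul_mem _ c h2
    simpa [smul_sub] using this

/-- The generalized inverse is single-valued. -/
theorem genInverseGraph_functional (T : H →L[ℂ] H) (p : H × H) (hp : p ∈ genInverseGraph T)
    (h0 : p.1 = 0) : p.2 = 0 := by
  obtain ⟨h1, h2⟩ := hp
  rw [h0, zero_sub, Submodule.neg_mem_iff] at h2
  have hT : T p.2 = 0 := by
    have := (Submodule.mem_orthogonal _ _).1 h2 (T p.2) ⟨p.2, rfl⟩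
    exact inner_self_eq_zero.1 this
  have := (Submodule.mem_orthogonal _ _).1 h1 p.2 hT
  exact inner_self_eq_zero.1 this

/-- The generalized inverse `T^g` of a bounded operator `T`: the (in general unbounded) operator
with domain `range T ⊕ (range T)ᗮ` that inverts `T` on its support `(ker T)ᗮ` and vanishes on
`(range T)ᗮ`. For self-adjoint `T` one has `(range T)ᗮ = ker T`. -/
def genInverse (T : H →L[ℂ] H) : H →ₗ.[ℂ] H :=
  (genInverseGraph T).toLinearPMap

theorem genInverse_graph (T : H →L[ℂ] H) : (genInverse T).graph = genInverseGraph T :=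
  Submodule.toLinearPMap_graph_eq _ (genInverseGraph_functional T)

/-- The operator norm `sup {‖f x‖ : x ∈ dom f, ‖x‖ ≤ 1} ∈ [0, ∞]` of a partially defined
operator. If the domain is dense and this is finite, it is the spectral norm of the unique bounded
extension of `f` to the whole space. -/
def opNorm (f : H →ₗ.[ℂ] H) : ℝ≥0∞ :=
  ⨆ (x : f.domain) (_ : ‖(x : H)‖ ≤ 1), ‖f x‖ₑ

/-- The operator `√A^g B √D^g` on its natural domain. -/
def normalizedOffDiag (A B D : H →L[ℂ] H) : H →ₗ.[ℂ] H :=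
  pcomp (genInverse (CFC.sqrt A))
    (LinearMap.compPMap (B : H →ₗ[ℂ] H) (genInverse (CFC.sqrt D)))

/-- Parseval's identity. -/
theorem parseval {ι : Type*} (b : HilbertBasis ι ℂ H) (x : H) :
    ENNReal.ofReal (‖x‖ ^ 2) = ∑' j, ENNReal.ofReal (‖⟪b j, x⟫_ℂ‖ ^ 2) := by
  have h : HasSum (fun j => ‖⟪b j, x⟫_ℂ‖ ^ 2) (‖x‖ ^ 2) := by
    have h2 := Complex.hasSum_re (b.hasSum_inner_mul_inner x x)
    convert! h2 using 1
    · funext j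
      rw [← inner_conj_symm x (b j), Complex.conj_mul']
      norm_cast
    · rw [inner_self_eq_norm_sq_to_K]
      norm_cast
  rw [← h.tsum_eq, ENNReal.ofReal_tsum_of_nonneg (fun _ => by positivity) h.summable]

/-- The trace of a positive operator may be computed in any orthonormal basis. -/
theorem posTrace_eq {ι : Type*} (b : HilbertBasis ι ℂ H) {T : H →L[ℂ] H} (hT : 0 ≤ T) :
    posTrace T = ∑' i, ENNReal.ofReal (⟪b i, T (b i)⟫_ℂ).re := by
  set S := CFC.sqrt T with hS
  have hSa : IsSelfAdjoint S := (CFC.sqrt_nonneg T).isSelfAdjoint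
  have hSym : ∀ x y, ⟪S x, y⟫_ℂ = ⟪x, S y⟫_ℂ := fun x y => by
    conv_rhs => rw [← hSa.adjoint_eq]
    rw [ContinuousLinearMap.adjoint_inner_right]
  have hTS : ∀ x, ENNReal.ofReal (⟪x, T x⟫_ℂ).re = ENNReal.ofReal (‖S x‖ ^ 2) := fun x => by
    have h1 : T x = S (S x) := by
      conv_lhs => rw [← CFC.sqrt_mul_sqrt_self T hT]
      rfl
    rw [h1, ← hSym, inner_self_eq_norm_sq_to_K]
    norm_cast
  unfold posTrace
  simp_rw [hTS]
  simp_rw [fun i => parseval b (S (stdBasis H i)), fun i => parseval (stdBasis H) (S (b i))]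
  rw [ENNReal.tsum_comm]
  refine tsum_congr fun j => tsum_congr fun i => ?_
  rw [← hSym, ← norm_inner_symm]

end QTrace

end

noncomputable section

namespace QTrace

variable {H : Type*} [NormedAddCommGroup H] [InnerProductSpace ℂ H] [CompleteSpace H]

/-! Positivity of `P` and Cauchy–Schwarz for `√P` give `|⟨x, B y⟩| ≤ ‖√A x‖ ‖√D y‖`
(`norm_inner_offDiag_le`). A Riesz argument turns this into a factorization of `B` through `√A` and
`√D`: `√A^g B √D^g` is a densely defined contraction, and its norm `k` may be inserted on the right
of the bound (`norm_inner_le_opNorm_normalizedOffDiag_mul`).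

With `X = √A √ρ` and `Y = √D √ρ`, the form of `√ρ H √ρ` is then at most `k (‖X x‖ ‖Y y‖ + ‖Y x‖ ‖X
y‖)`, so its trace norm is at most `2 k ‖X‖₂ ‖Y‖₂` (`traceNorm_le_of_norm_inner_le`). Finally `‖X‖₂²
= r Tr(ρΠ)` and `‖Y‖₂² = s Tr(ρΠ̄)`; bounding the traces by `1` and `W` and using `2√(rs) ≤ r + s`
finishes the proof. -/

/-! ### Square roots of positive operators and range inclusion. -/

theorem inner_star_apply_left (T : H →L[ℂ] H) (x y : H) : ⟪(star T) x, y⟫_ℂ = ⟪x, T y⟫_ℂ := by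
  rw [ContinuousLinearMap.star_eq_adjoint, ContinuousLinearMap.adjoint_inner_left]

theorem inner_apply_of_isSelfAdjoint {T : H →L[ℂ] H} (hT : IsSelfAdjoint T) (x y : H) :
    ⟪T x, y⟫_ℂ = ⟪x, T y⟫_ℂ := by
  simpa [hT.star_eq] using inner_star_apply_left T x y

theorem inner_apply_eq_norm_sqrt_sq {T : H →L[ℂ] H} (hT : 0 ≤ T) (x : H) :
    ⟪x, T x⟫_ℂ = ((‖CFC.sqrt T x‖ ^ 2 : ℝ) : ℂ) := by
  conv_lhs => rw [← CFC.sqrt_mul_sqrt_self T hT]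
  rw [mul_apply_eq_comp,
    ← inner_apply_of_isSelfAdjoint (CFC.sqrt_nonneg T).isSelfAdjoint, inner_self_eq_norm_sq_to_K]
  norm_cast

theorem norm_sqrt_star_mul_self_apply (X : H →L[ℂ] H) (x : H) :
    ‖CFC.sqrt (star X * X) x‖ = ‖X x‖ := by
  have h := inner_apply_eq_norm_sqrt_sq (star_mul_self_nonneg X) x
  rw [mul_apply_eq_comp, ← inner_conj_symm, inner_star_apply_left,
    inner_self_eq_norm_sq_to_K] at h
  have h2 : ‖X x‖ ^ 2 = ‖CFC.sqrt (star X * X) x‖ ^ 2 := by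
    rw [← Complex.ofReal_inj, ← h]
    simp
  exact ((sq_eq_sq₀ (norm_nonneg _) (norm_nonneg _)).1 h2).symm

/-- If the functional `⟨v, ·⟩` is dominated by `c ‖S ·‖` for a self-adjoint `S`, then `v` is in the
range of `S`, with a preimage in the support of `S` of norm at most `c`. -/
theorem exists_mem_ker_orthogonal_apply_eq {S : H →L[ℂ] H} (hS : IsSelfAdjoint S) {v : H} {c : ℝ}
    (hc : 0 ≤ c) (h : ∀ u, ‖⟪v, u⟫_ℂ‖ ≤ c * ‖S u‖) :
    ∃ w ∈ (S.ker)ᗮ, S w = v ∧ ‖w‖ ≤ c := by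
  -- The functional `S u ↦ ⟨v, u⟩` on the range of `S` is defined through a linear section `g`; it
  -- is extended by Hahn–Banach and represented by `w`.
  obtain ⟨g, hg⟩ := (S : H →ₗ[ℂ] H).rangeRestrict.exists_rightInverse_of_surjective
    (LinearMap.range_rangeRestrict _)
  have hg' : ∀ y, S (g y) = (y : H) := fun y =>
    congrArg Subtype.val (LinearMap.congr_fun hg y)
  let f : StrongDual ℂ (S : H →ₗ[ℂ] H).range :=
    LinearMap.mkContinuous ((innerSL ℂ v : H →ₗ[ℂ] ℂ) ∘ₗ g) c fun y => by
      have := h (g y)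
      rw [hg'] at this
      simpa using this
  obtain ⟨F, hF, hFn⟩ := exists_extension_norm_eq _ f
  have hfn : ‖f‖ ≤ c := LinearMap.mkContinuous_norm_le _ hc _
  set w := (InnerProductSpace.toDual ℂ H).symm F with hw
  have hwn : ‖w‖ ≤ c := by rw [hw, LinearIsometryEquiv.norm_map, hFn]; exact hfn
  have hSw : S w = v := by
    refine ext_inner_right ℂ fun u => ?_
    rw [inner_apply_of_isSelfAdjoint hS, hw, InnerProductSpace.toDual_symm_apply]
    have h1 := hF ⟨S u, u, rfl⟩
    have h2 : f ⟨S u, u, rfl⟩ = ⟪v, g ⟨S u, u, rfl⟩⟫_ℂ := rfl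
    -- Independence of the section: `S` kills `u - g (S u)`, hence by domination so does `⟨v, ·⟩`.
    rw [show F (S u) = _ from h1, h2, ← sub_eq_zero, ← inner_sub_right, ← norm_le_zero_iff]
    refine (h _).trans_eq ?_
    rw [map_sub, hg']
    simp
  obtain ⟨a, ha, b, hb, hab⟩ := S.ker.exists_add_mem_mem_orthogonal w
  have ha' : S a = 0 := ha
  refine ⟨b, hb, ?_, ?_⟩
  · rw [← hSw, hab, map_add, ha', zero_add]
  · refine le_trans ?_ hwn
    have hp := norm_add_sq_eq_norm_sq_add_norm_sq_of_inner_eq_zero a b (hb a ha)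
    rw [← hab] at hp
    exact (sq_le_sq₀ (norm_nonneg _) (norm_nonneg _)).1 (by nlinarith [norm_nonneg a])

/-! ### Graphs and domains of generalized inverses. -/

theorem mem_graph_pcomp_iff {g f : H →ₗ.[ℂ] H} {x z : H} :
    (x, z) ∈ (pcomp g f).graph ↔ ∃ y, (x, y) ∈ f.graph ∧ (y, z) ∈ g.graph := by
  simp only [LinearPMap.mem_graph_iff]
  constructor
  · rintro ⟨⟨_, y, hy, rfl⟩, rfl, rfl⟩
    exact ⟨f y, ⟨y, rfl, rfl⟩, ⟨f y, hy⟩, rfl, rfl⟩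
  · rintro ⟨_, ⟨y, rfl, rfl⟩, ⟨w, hw, rfl⟩⟩
    have hy : f y ∈ g.domain := hw ▸ w.2
    refine ⟨⟨y, y, hy, rfl⟩, rfl, ?_⟩
    change g ⟨f y, hy⟩ = g w
    congr 1
    exact Subtype.ext hw.symm

theorem mem_graph_normalizedOffDiag_iff {A B D : H →L[ℂ] H} {y w : H} :
    (y, w) ∈ (normalizedOffDiag A B D).graph ↔
      ∃ x, (y, x) ∈ genInverseGraph (CFC.sqrt D) ∧ (B x, w) ∈ genInverseGraph (CFC.sqrt A) := by
  rw [normalizedOffDiag, mem_graph_pcomp_iff]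
  simp only [genInverse_graph]
  rw [← genInverse_graph (CFC.sqrt D)]
  simp only [LinearPMap.mem_graph_iff]
  constructor
  · rintro ⟨_, ⟨y, rfl, rfl⟩, h⟩
    exact ⟨_, ⟨y, rfl, rfl⟩, h⟩
  · rintro ⟨_, ⟨y, rfl, rfl⟩, h⟩
    exact ⟨_, ⟨y, rfl, rfl⟩, h⟩

/-- The domain `range T ⊕ (range T)ᗮ` of the generalized inverse is dense. -/
theorem dense_domain_genInverse (T : H →L[ℂ] H) : Dense ((genInverse T).domain : Set H) := by
  have hmem : ∀ y, y ∈ (genInverse T).domain ↔ ∃ x, (y, x) ∈ genInverseGraph T := fun y => by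
    rw [LinearPMap.mem_domain_iff, genInverse_graph]
  rw [Submodule.dense_iff_topologicalClosure_eq_top, ← Submodule.orthogonal_eq_bot_iff,
    Submodule.orthogonal_closure]
  rw [Submodule.eq_bot_iff]
  intro z hz
  have hzr : z ∈ (T.range)ᗮ := by
    rw [Submodule.mem_orthogonal]
    rintro _ ⟨u, rfl⟩
    obtain ⟨a, ha, b, hb, rfl⟩ := T.ker.exists_add_mem_mem_orthogonal u
    refine hz _ ((hmem _).2 ⟨b, hb, ?_⟩)
    have ha' : T a = 0 := ha
    simp [ha']
  -- Being orthogonal to the range, `z` itself lies in the domain, with value `0`, so it is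
  -- orthogonal to itself.
  exact inner_self_eq_zero.1 (hz z ((hmem z).2 ⟨0, zero_mem _, by simpa using hzr⟩))

theorem enorm_apply_le_opNorm {f : H →ₗ.[ℂ] H} (x : f.domain) (hx : ‖(x : H)‖ ≤ 1) :
    ‖f x‖ₑ ≤ opNorm f :=
  le_iSup₂ (f := fun (x : f.domain) (_ : ‖(x : H)‖ ≤ 1) => ‖f x‖ₑ) x hx

theorem norm_apply_le_opNorm_mul {f : H →ₗ.[ℂ] H} (hf : opNorm f < ⊤) (x : f.domain) :
    ‖f x‖ ≤ (opNorm f).toReal * ‖(x : H)‖ := by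
  by_cases hx : (x : H) = 0
  · have : x = 0 := Subtype.ext hx
    simp [this]
  have hpos : 0 < ‖(x : H)‖ := norm_pos_iff.2 hx
  have h1 := enorm_apply_le_opNorm (f := f) (((‖(x : H)‖⁻¹ : ℝ) : ℂ) • x) (by
    rw [Submodule.coe_smul, norm_smul]
    simp [hpos.ne'])
  have h2 := ENNReal.toReal_mono hf.ne h1
  rw [toReal_enorm, f.map_smul, norm_smul] at h2
  simp only [Complex.norm_real, norm_inv, norm_norm] at h2
  rwa [inv_mul_le_iff₀ hpos, mul_comm] at h2

/-! ### The normalized off-diagonal block. -/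

section OffDiag

variable {A B D : H →L[ℂ] H}

/-- The form bound puts `B x` in the range of `√A`, so the second inverse never shrinks the domain
of `√D^g`. Its value has norm at most `‖√D x‖`, and `√D x` is an orthogonal component of `y`. -/
theorem exists_mem_graph_normalizedOffDiag
    (h : ∀ x y, ‖⟪x, B y⟫_ℂ‖ ≤ ‖CFC.sqrt A x‖ * ‖CFC.sqrt D y‖) {y : H}
    (hy : y ∈ (genInverse (CFC.sqrt D)).domain) :
    ∃ w, (y, w) ∈ (normalizedOffDiag A B D).graph ∧ ‖w‖ ≤ ‖y‖ := by
  rw [LinearPMap.mem_domain_iff, genInverse_graph] at hy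
  obtain ⟨x, hx⟩ := hy
  obtain ⟨w, hw, hwB, hwn⟩ := exists_mem_ker_orthogonal_apply_eq
    (CFC.sqrt_nonneg A).isSelfAdjoint (v := B x) (norm_nonneg (CFC.sqrt D x)) fun u => by
      rw [norm_inner_symm, mul_comm]
      exact h u x
  refine ⟨w, mem_graph_normalizedOffDiag_iff.2 ⟨x, hx, hw, by simp [hwB]⟩, hwn.trans ?_⟩
  have horth := (Submodule.mem_orthogonal _ _).1 hx.2 (CFC.sqrt D x) ⟨x, rfl⟩
  have hp := norm_add_sq_eq_norm_sq_add_norm_sq_of_inner_eq_zero _ _ horth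
  simp only [add_sub_cancel] at hp
  exact (sq_le_sq₀ (norm_nonneg _) (norm_nonneg _)).1
    (by nlinarith [norm_nonneg (y - CFC.sqrt D x)])

theorem dense_domain_normalizedOffDiag
    (h : ∀ x y, ‖⟪x, B y⟫_ℂ‖ ≤ ‖CFC.sqrt A x‖ * ‖CFC.sqrt D y‖) :
    Dense ((normalizedOffDiag A B D).domain : Set H) := by
  refine (dense_domain_genInverse (CFC.sqrt D)).mono fun y hy => ?_
  obtain ⟨w, hw, _⟩ := exists_mem_graph_normalizedOffDiag h hy
  exact LinearPMap.mem_domain_of_mem_graph hw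

theorem opNorm_normalizedOffDiag_le_one
    (h : ∀ x y, ‖⟪x, B y⟫_ℂ‖ ≤ ‖CFC.sqrt A x‖ * ‖CFC.sqrt D y‖) :
    opNorm (normalizedOffDiag A B D) ≤ 1 := by
  refine iSup₂_le fun y hy => ?_
  have hyg := LinearPMap.mem_graph _ y
  obtain ⟨x, hx, -⟩ := mem_graph_normalizedOffDiag_iff.1 hyg
  obtain ⟨w, hw, hwn⟩ := exists_mem_graph_normalizedOffDiag h (y := y) (by
    rw [LinearPMap.mem_domain_iff, genInverse_graph]
    exact ⟨x, hx⟩)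
  rw [LinearPMap.mem_graph_snd_inj _ hyg hw rfl, ← ofReal_norm, ENNReal.ofReal_le_one]
  exact hwn.trans hy

/-- The matrix elements of `B` are controlled by the norm of `√A^g B √D^g`. -/
theorem norm_inner_le_opNorm_normalizedOffDiag_mul
    (h : ∀ x y, ‖⟪x, B y⟫_ℂ‖ ≤ ‖CFC.sqrt A x‖ * ‖CFC.sqrt D y‖) (x y : H) :
    ‖⟪x, B y⟫_ℂ‖ ≤
      (opNorm (normalizedOffDiag A B D)).toReal * (‖CFC.sqrt A x‖ * ‖CFC.sqrt D y‖) := by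
  obtain ⟨a, ha, b, hb, rfl⟩ := (CFC.sqrt D).ker.exists_add_mem_mem_orthogonal y
  have ha' : CFC.sqrt D a = 0 := ha
  have hBa : B a = 0 := by
    rw [← inner_self_eq_zero (𝕜 := ℂ), ← norm_le_zero_iff]
    simpa [ha'] using h (B a) a
  rw [map_add, map_add, ha', hBa, zero_add, zero_add]
  obtain ⟨w, hw, -⟩ := exists_mem_graph_normalizedOffDiag h (y := CFC.sqrt D b) (by
    rw [LinearPMap.mem_domain_iff, genInverse_graph]
    exact ⟨b, hb, by simp⟩)
  have hbw : (B b, w) ∈ genInverseGraph (CFC.sqrt A) := by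
    obtain ⟨b', hb', hw'⟩ := mem_graph_normalizedOffDiag_iff.1 hw
    have hbb : (CFC.sqrt D b, b) ∈ genInverseGraph (CFC.sqrt D) := ⟨hb, by simp⟩
    rw [← genInverse_graph] at hb' hbb
    rwa [LinearPMap.mem_graph_snd_inj _ hb' hbb rfl] at hw'
  have hnw : ‖w‖ ≤ (opNorm (normalizedOffDiag A B D)).toReal * ‖CFC.sqrt D b‖ := by
    obtain ⟨z, hz, hzw⟩ := (LinearPMap.mem_graph_iff _).1 hw
    simp only at hz hzw
    rw [← hz, ← hzw]
    exact norm_apply_le_opNorm_mul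
      ((opNorm_normalizedOffDiag_le_one h).trans_lt ENNReal.one_lt_top) z
  -- In general `√A w` is only the projection of `B b` onto the closed range of `√A`; equality needs
  -- `B b` to lie in the range itself.
  have hBw : B b = CFC.sqrt A w := by
    have hr : B b ∈ ((CFC.sqrt A : H →L[ℂ] H) : H →ₗ[ℂ] H).range := by
      obtain ⟨v, -, hv, -⟩ := exists_mem_ker_orthogonal_apply_eq
        (CFC.sqrt_nonneg A).isSelfAdjoint (v := B b) (norm_nonneg (CFC.sqrt D b)) fun u => by
          rw [norm_inner_symm, mul_comm]
          exact h u b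
      exact ⟨v, hv⟩
    have hsub : B b - CFC.sqrt A w ∈ ((CFC.sqrt A : H →L[ℂ] H) : H →ₗ[ℂ] H).range :=
      Submodule.sub_mem _ hr ⟨w, rfl⟩
    exact sub_eq_zero.1 (inner_self_eq_zero.1
      ((Submodule.mem_orthogonal _ _).1 hbw.2 _ hsub))
  rw [hBw, ← inner_apply_of_isSelfAdjoint (CFC.sqrt_nonneg A).isSelfAdjoint]
  calc _ ≤ ‖CFC.sqrt A x‖ * ‖w‖ := norm_inner_le_norm _ _
    _ ≤ ‖CFC.sqrt A x‖ * ((opNorm (normalizedOffDiag A B D)).toReal * ‖CFC.sqrt D b‖) := by gcongr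
    _ = _ := by ring

end OffDiag

/-! ### Hilbert–Schmidt operators, cyclicity of the trace and the trace norm. -/

/-- The square `∑ᵢ ‖X eᵢ‖² ∈ [0, ∞]` of the Hilbert–Schmidt norm. -/
def hilbertSchmidtSq (X : H →L[ℂ] H) : ℝ≥0∞ :=
  ∑' i, ENNReal.ofReal (‖X (stdBasis H i)‖ ^ 2)

theorem hilbertSchmidtSq_eq_tsum_tsum (X : H →L[ℂ] H) :
    hilbertSchmidtSq X =
      ∑' i, ∑' j, ENNReal.ofReal (‖⟪stdBasis H j, X (stdBasis H i)⟫_ℂ‖ ^ 2) :=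
  tsum_congr fun _ => parseval _ _

theorem hilbertSchmidtSq_star (X : H →L[ℂ] H) :
    hilbertSchmidtSq (star X) = hilbertSchmidtSq X := by
  rw [hilbertSchmidtSq_eq_tsum_tsum, hilbertSchmidtSq_eq_tsum_tsum, ENNReal.tsum_comm]
  refine tsum_congr fun j => tsum_congr fun i => ?_
  rw [norm_inner_symm, inner_star_apply_left]

theorem hilbertSchmidtSq_le_of_norm_apply_le {X Y : H →L[ℂ] H} (h : ∀ x, ‖X x‖ ≤ ‖Y x‖) :
    hilbertSchmidtSq X ≤ hilbertSchmidtSq Y :=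
  ENNReal.tsum_le_tsum fun _ => ENNReal.ofReal_le_ofReal (by gcongr; exact h _)

theorem hilbertSchmidtSq_mul_le {C : H →L[ℂ] H} (hC : ‖C‖ ≤ 1) (X : H →L[ℂ] H) :
    hilbertSchmidtSq (C * X) ≤ hilbertSchmidtSq X :=
  hilbertSchmidtSq_le_of_norm_apply_le fun x => by
    simpa using C.le_of_opNorm_le hC (X x)

theorem hilbertSchmidtSq_mul_le' {C : H →L[ℂ] H} (hC : ‖C‖ ≤ 1) (X : H →L[ℂ] H) :
    hilbertSchmidtSq (X * C) ≤ hilbertSchmidtSq X := by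
  rw [← hilbertSchmidtSq_star, star_mul, ← hilbertSchmidtSq_star X]
  exact hilbertSchmidtSq_mul_le (by rwa [norm_star]) _

theorem hilbertSchmidtSq_toReal (X : H →L[ℂ] H) :
    (hilbertSchmidtSq X).toReal = ∑' i, ‖X (stdBasis H i)‖ ^ 2 := by
  rw [hilbertSchmidtSq, ENNReal.tsum_toReal_eq fun _ => ENNReal.ofReal_ne_top]
  exact tsum_congr fun i => ENNReal.toReal_ofReal (by positivity)

theorem sum_norm_sq_le_hilbertSchmidtSq {X : H →L[ℂ] H} (hX : hilbertSchmidtSq X < ⊤)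
    (F : Finset (basisIndex H)) :
    ∑ i ∈ F, ‖X (stdBasis H i)‖ ^ 2 ≤ (hilbertSchmidtSq X).toReal := by
  rw [← ENNReal.ofReal_le_iff_le_toReal hX.ne,
    ENNReal.ofReal_sum_of_nonneg fun _ _ => by positivity]
  exact ENNReal.sum_le_tsum F

theorem summable_norm_inner_sq {X : H →L[ℂ] H} (hX : hilbertSchmidtSq X < ⊤) :
    Summable fun p : basisIndex H × basisIndex H =>
      ‖⟪stdBasis H p.2, X (stdBasis H p.1)⟫_ℂ‖ ^ 2 := by
  rw [hilbertSchmidtSq_eq_tsum_tsum, ← ENNReal.tsum_prod] at hX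
  refine (ENNReal.summable_toReal hX.ne).congr fun p => ?_
  exact ENNReal.toReal_ofReal (sq_nonneg _)

/-- The trace is cyclic on products of Hilbert–Schmidt operators. -/
theorem trace_mul_comm {X Y : H →L[ℂ] H} (hX : hilbertSchmidtSq X < ⊤)
    (hY : hilbertSchmidtSq Y < ⊤) : trace (X * Y) = trace (Y * X) := by
  have key : ∀ (X Y : H →L[ℂ] H), trace (X * Y) = ∑' i, ∑' j,
      ⟪stdBasis H i, X (stdBasis H j)⟫_ℂ * ⟪stdBasis H j, Y (stdBasis H i)⟫_ℂ := fun X Y => by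
    refine tsum_congr fun i => ?_
    rw [mul_apply_eq_comp, ← inner_star_apply_left,
      ← ((stdBasis H).hasSum_inner_mul_inner _ _).tsum_eq]
    simp_rw [inner_star_apply_left]
  rw [key, key, Summable.tsum_comm]
  · exact tsum_congr fun i => tsum_congr fun j => mul_comm _ _
  -- The interchange of sums is justified by `|ab| ≤ a² + b²` on matrix entries.
  · refine Summable.of_norm_bounded
      ((summable_norm_inner_sq hX).add (summable_norm_inner_sq hY).prod_symm) fun p => ?_
    simp only [Function.uncurry, norm_mul, Prod.fst_swap, Prod.snd_swap]
    nlinarith [sq_nonneg (‖⟪stdBasis H p.2, X (stdBasis H p.1)⟫_ℂ‖ -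
      ‖⟪stdBasis H p.1, Y (stdBasis H p.2)⟫_ℂ‖),
      sq_nonneg (‖⟪stdBasis H p.2, X (stdBasis H p.1)⟫_ℂ‖ +
      ‖⟪stdBasis H p.1, Y (stdBasis H p.2)⟫_ℂ‖)]

theorem trace_smul (c : ℂ) (T : H →L[ℂ] H) : trace (c • T) = c * trace T := by
  simp [trace, tsum_mul_left]

theorem trace_star_mul_self (X : H →L[ℂ] H) :
    trace (star X * X) = ((hilbertSchmidtSq X).toReal : ℂ) := by
  rw [hilbertSchmidtSq_toReal, Complex.ofReal_tsum]
  refine tsum_congr fun i => ?_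
  rw [mul_apply_eq_comp, ← inner_conj_symm, inner_star_apply_left, inner_self_eq_norm_sq_to_K]
  simp

/-- An approximate polar decomposition of a self-adjoint operator. -/
theorem exists_norm_abs_sub_mul_le {T : H →L[ℂ] H} (hT : IsSelfAdjoint T) {ε : ℝ} (hε : 0 < ε) :
    ∃ C : H →L[ℂ] H, IsSelfAdjoint C ∧ ‖C‖ ≤ 1 ∧ ‖CFC.abs T - C * T‖ ≤ ε := by
  -- `x / (|x| + ε)` is a continuous substitute for the sign function; the error `ε |x| / (|x| + ε)`
  -- is at most `ε`.
  have hpos : ∀ x : ℝ, 0 < |x| + ε := fun x => by positivity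
  have hcont : Continuous fun x : ℝ => x / (|x| + ε) :=
    continuous_id.div (by fun_prop) fun x => (hpos x).ne'
  refine ⟨cfc (fun x : ℝ => x / (|x| + ε)) T, cfc_predicate _ _, norm_cfc_le zero_le_one ?_, ?_⟩
  · intro x _
    rw [norm_div, Real.norm_eq_abs, Real.norm_of_nonneg (hpos x).le, div_le_one (hpos x)]
    linarith
  · have h1 : cfc (fun x : ℝ => x / (|x| + ε)) T * T = cfc (fun x : ℝ => x / (|x| + ε) * x) T := by
      rw [cfc_mul (fun x : ℝ => x / (|x| + ε)) (fun x => x) T hcont.continuousOn, cfc_id' ℝ T]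
    rw [h1, CFC.abs_eq_cfc_norm T,
      ← cfc_sub (fun x : ℝ => ‖x‖) (fun x : ℝ => x / (|x| + ε) * x) T (by fun_prop) (hcont.mul continuous_id).continuousOn]
    refine norm_cfc_le hε.le fun x _ => ?_
    have : ‖x‖ - x / (|x| + ε) * x = |x| / (|x| + ε) * ε := by
      rw [Real.norm_eq_abs]
      have := (hpos x).ne'
      field_simp
      rw [← sq_abs x]
      ring
    rw [this, Real.norm_of_nonneg (by positivity)]
    have h2 : |x| / (|x| + ε) ≤ 1 := (div_le_one (hpos x)).2 (by linarith)
    nlinarith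

/-- A trace norm bound for a self-adjoint operator from a bound of its sesquilinear form in terms
of two Hilbert–Schmidt operators. -/
theorem traceNorm_le_of_norm_inner_le {T X Y : H →L[ℂ] H} (hT : IsSelfAdjoint T)
    (hX : hilbertSchmidtSq X < ⊤) (hY : hilbertSchmidtSq Y < ⊤) {k : ℝ} (hk : 0 ≤ k)
    (h : ∀ x y, ‖⟪x, T y⟫_ℂ‖ ≤ k * (‖X x‖ * ‖Y y‖ + ‖Y x‖ * ‖X y‖)) :
    traceNorm T ≤ ENNReal.ofReal
      (2 * k * √(hilbertSchmidtSq X).toReal * √(hilbertSchmidtSq Y).toReal) := by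
  rw [traceNorm, posTrace, ENNReal.tsum_eq_iSup_sum]
  refine iSup_le fun F => ?_
  have hnn : ∀ i, 0 ≤ (⟪stdBasis H i, CFC.abs T (stdBasis H i)⟫_ℂ).re := fun i => by
    rw [inner_apply_eq_norm_sqrt_sq (CFC.abs_nonneg T), Complex.ofReal_re]
    positivity
  rw [← ENNReal.ofReal_sum_of_nonneg fun i _ => hnn i]
  refine ENNReal.ofReal_le_ofReal ?_
  refine le_of_forall_pos_le_add fun δ hδ => ?_
  -- The polar error is paid once per index of `F`, so its total is at most `δ`; the `+ 1` covers
  -- empty `F`.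
  have hε : 0 < δ / (F.card + 1) := by positivity
  obtain ⟨C, hC, hC1, hCT⟩ := exists_norm_abs_sub_mul_le hT hε
  have hCS : ∀ {X Y : H →L[ℂ] H}, hilbertSchmidtSq X < ⊤ → hilbertSchmidtSq Y < ⊤ →
      ∑ i ∈ F, ‖X (C (stdBasis H i))‖ * ‖Y (stdBasis H i)‖ ≤
        √(hilbertSchmidtSq X).toReal * √(hilbertSchmidtSq Y).toReal := fun {X Y} hX hY => by
    refine (Real.sum_mul_le_sqrt_mul_sqrt _ _ _).trans ?_
    have hXC := hilbertSchmidtSq_mul_le' hC1 X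
    have h1 := (sum_norm_sq_le_hilbertSchmidtSq (hXC.trans_lt hX) F).trans
      (ENNReal.toReal_mono hX.ne hXC)
    have h2 := sum_norm_sq_le_hilbertSchmidtSq hY F
    gcongr
    exact h1
  have hterm : ∀ i, (⟪stdBasis H i, CFC.abs T (stdBasis H i)⟫_ℂ).re ≤
      k * (‖X (C (stdBasis H i))‖ * ‖Y (stdBasis H i)‖ +
        ‖Y (C (stdBasis H i))‖ * ‖X (stdBasis H i)‖) + δ / (F.card + 1) := fun i => by
    have hn : ‖stdBasis H i‖ = 1 := (stdBasis H).orthonormal.1 i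
    have h1 : CFC.abs T (stdBasis H i) =
        C (T (stdBasis H i)) + (CFC.abs T - C * T) (stdBasis H i) := by simp
    rw [h1, inner_add_right, Complex.add_re, ← inner_apply_of_isSelfAdjoint hC]
    refine add_le_add ((Complex.re_le_norm _).trans (h _ _)) ((Complex.re_le_norm _).trans ?_)
    refine (norm_inner_le_norm _ _).trans ?_
    rw [hn, one_mul]
    simpa [hn] using (CFC.abs T - C * T).le_of_opNorm_le hCT (stdBasis H i)
  refine (Finset.sum_le_sum fun i _ => hterm i).trans ?_
  rw [Finset.sum_add_distrib, ← Finset.mul_sum, Finset.sum_add_distrib, Finset.sum_const,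
    nsmul_eq_mul]
  have hcard : (F.card : ℝ) * (δ / (F.card + 1)) ≤ δ := by
    rw [mul_div_assoc', div_le_iff₀ (by positivity)]
    nlinarith
  have h1 := mul_le_mul_of_nonneg_left (add_le_add (hCS hX hY) (hCS hY hX)) hk
  linarith

/-! ### Traces against a state as Hilbert–Schmidt norms. -/

section State

variable {ρ P Q : H →L[ℂ] H}

theorem IsState.hilbertSchmidtSq_sqrt (hρ : IsState ρ) : hilbertSchmidtSq (CFC.sqrt ρ) = 1 := by
  have hsa : star (CFC.sqrt ρ) = CFC.sqrt ρ := (CFC.sqrt_nonneg ρ).isSelfAdjoint.star_eq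
  have h1 := trace_star_mul_self (CFC.sqrt ρ)
  rw [hsa, CFC.sqrt_mul_sqrt_self ρ hρ.nonneg, hρ.trace_eq_one] at h1
  rw [← ENNReal.toReal_eq_one_iff]
  exact_mod_cast h1.symm

theorem IsState.hilbertSchmidtSq_mul_sqrt_lt_top (hρ : IsState ρ) (X : H →L[ℂ] H) :
    hilbertSchmidtSq (X * CFC.sqrt ρ) < ⊤ := by
  have h : hilbertSchmidtSq (X * CFC.sqrt ρ) ≤
      ENNReal.ofReal (‖X‖ ^ 2) * hilbertSchmidtSq (CFC.sqrt ρ) := by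
    rw [hilbertSchmidtSq, hilbertSchmidtSq, ← ENNReal.tsum_mul_left]
    refine ENNReal.tsum_le_tsum fun i => ?_
    rw [← ENNReal.ofReal_mul (by positivity), ← mul_pow]
    refine ENNReal.ofReal_le_ofReal ?_
    gcongr
    exact X.le_opNorm _
  rw [hρ.hilbertSchmidtSq_sqrt, mul_one] at h
  exact h.trans_lt ENNReal.ofReal_lt_top

theorem IsState.hilbertSchmidtSq_sqrt_mul_lt_top (hρ : IsState ρ) (X : H →L[ℂ] H) :
    hilbertSchmidtSq (CFC.sqrt ρ * X) < ⊤ := by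
  rw [← hilbertSchmidtSq_star, star_mul, (CFC.sqrt_nonneg ρ).isSelfAdjoint.star_eq]
  exact hρ.hilbertSchmidtSq_mul_sqrt_lt_top _

/-- `Tr(ρ Q) = ‖Q √ρ‖₂²` for a projection `Q`. -/
theorem IsState.trace_mul_isStarProjection (hρ : IsState ρ) (hQ : IsStarProjection Q) :
    trace (ρ * Q) = ((hilbertSchmidtSq (Q * CFC.sqrt ρ)).toReal : ℂ) := by
  have hsa : star (CFC.sqrt ρ) = CFC.sqrt ρ := (CFC.sqrt_nonneg ρ).isSelfAdjoint.star_eq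
  rw [← trace_star_mul_self, star_mul, hsa, hQ.isSelfAdjoint.star_eq]
  conv_lhs => rw [← CFC.sqrt_mul_sqrt_self ρ hρ.nonneg, mul_assoc]
  -- Splitting `ρ` into two square roots makes both factors Hilbert–Schmidt, so cyclicity applies.
  rw [trace_mul_comm (by rw [hρ.hilbertSchmidtSq_sqrt]; exact ENNReal.one_lt_top)
    (hρ.hilbertSchmidtSq_sqrt_mul_lt_top Q)]
  simp only [mul_assoc]
  rw [← mul_assoc Q Q, hQ.isIdempotentElem.eq]

/-- `√(QPQ)` is the absolute value of `√P Q`. -/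
theorem norm_sqrt_apply_compression (hP : 0 ≤ P) (hQ : IsStarProjection Q) (x : H) :
    ‖CFC.sqrt (Q * P * Q) x‖ = ‖CFC.sqrt P (Q x)‖ := by
  have h : Q * P * Q = star (CFC.sqrt P * Q) * (CFC.sqrt P * Q) := by
    rw [star_mul, (CFC.sqrt_nonneg P).isSelfAdjoint.star_eq, hQ.isSelfAdjoint.star_eq]
    conv_lhs => rw [← CFC.sqrt_mul_sqrt_self P hP]
    simp only [mul_assoc]
  rw [h, norm_sqrt_star_mul_self_apply, mul_apply_eq_comp]

theorem IsPOVMElement.norm_sqrt_apply_le (hP : IsPOVMElement P) (x : H) :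
    ‖CFC.sqrt P x‖ ≤ ‖x‖ := by
  have h1 := inner_apply_eq_norm_sqrt_sq hP.nonneg x
  have h2 := inner_apply_eq_norm_sqrt_sq (sub_nonneg.2 hP.le_one) x
  rw [sub_apply, inner_sub_right, h1, one_apply_eq_self,
    inner_self_eq_norm_sq_to_K] at h2
  have h3 : ‖x‖ ^ 2 - ‖CFC.sqrt P x‖ ^ 2 = ‖CFC.sqrt (1 - P) x‖ ^ 2 := by
    simpa [← Complex.ofReal_pow] using congrArg Complex.re h2
  exact (sq_le_sq₀ (norm_nonneg _) (norm_nonneg _)).1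
    (by nlinarith [sq_nonneg ‖CFC.sqrt (1 - P) x‖])

/-- `Tr(Q ρ Q P) = ‖√(Q P Q) √ρ‖₂²` for a projection `Q`. -/
theorem IsState.trace_compression_mul (hρ : IsState ρ) (hP : 0 ≤ P) (hQ : IsStarProjection Q) :
    trace (Q * ρ * Q * P) =
      ((hilbertSchmidtSq (CFC.sqrt (Q * P * Q) * CFC.sqrt ρ)).toReal : ℂ) := by
  have hsa : star (CFC.sqrt ρ) = CFC.sqrt ρ := (CFC.sqrt_nonneg ρ).isSelfAdjoint.star_eq
  have hA : (0 : H →L[ℂ] H) ≤ Q * P * Q := by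
    simpa [hQ.isSelfAdjoint.star_eq] using star_left_conjugate_nonneg hP Q
  rw [← trace_star_mul_self, star_mul, hsa, (CFC.sqrt_nonneg (Q * P * Q)).isSelfAdjoint.star_eq]
  have h1 : CFC.sqrt ρ * CFC.sqrt (Q * P * Q) * (CFC.sqrt (Q * P * Q) * CFC.sqrt ρ) =
      CFC.sqrt ρ * (Q * P) * (Q * CFC.sqrt ρ) := by
    rw [mul_assoc, ← mul_assoc (CFC.sqrt (Q * P * Q)), CFC.sqrt_mul_sqrt_self _ hA]
    simp only [mul_assoc]
  rw [h1, ← trace_mul_comm (hρ.hilbertSchmidtSq_mul_sqrt_lt_top Q)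
    (hρ.hilbertSchmidtSq_sqrt_mul_lt_top _)]
  conv_lhs => rw [← CFC.sqrt_mul_sqrt_self ρ hρ.nonneg]
  simp only [mul_assoc]

/-- The outcome probability of the normalized compressed state. -/
theorem IsState.trace_normalized_compression_mul (hρ : IsState ρ) (hP : 0 ≤ P)
    (hQ : IsStarProjection Q) :
    (trace ((trace (ρ * Q))⁻¹ • (Q * ρ * Q) * P)).re =
      (hilbertSchmidtSq (CFC.sqrt (Q * P * Q) * CFC.sqrt ρ)).toReal /
        (hilbertSchmidtSq (Q * CFC.sqrt ρ)).toReal := by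
  rw [smul_mul_assoc, trace_smul, hρ.trace_compression_mul hP hQ,
    hρ.trace_mul_isStarProjection hQ, ← Complex.ofReal_inv, ← Complex.ofReal_mul,
    Complex.ofReal_re, inv_mul_eq_div]

theorem IsState.hilbertSchmidtSq_sqrt_compression_le (hρ : IsState ρ) (hP : IsPOVMElement P)
    (hQ : IsStarProjection Q) :
    (hilbertSchmidtSq (CFC.sqrt (Q * P * Q) * CFC.sqrt ρ)).toReal ≤
      (hilbertSchmidtSq (Q * CFC.sqrt ρ)).toReal :=
  ENNReal.toReal_mono (hρ.hilbertSchmidtSq_mul_sqrt_lt_top Q).ne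
    (hilbertSchmidtSq_le_of_norm_apply_le fun x => by
      rw [mul_apply_eq_comp, norm_sqrt_apply_compression hP.nonneg hQ]
      exact hP.norm_sqrt_apply_le _)

theorem IsState.hilbertSchmidtSq_isStarProjection_mul_le_one (hρ : IsState ρ)
    (hQ : IsStarProjection Q) : (hilbertSchmidtSq (Q * CFC.sqrt ρ)).toReal ≤ 1 := by
  have h := hilbertSchmidtSq_mul_le hQ.norm_le (CFC.sqrt ρ)
  rw [hρ.hilbertSchmidtSq_sqrt] at h
  exact ENNReal.toReal_mono ENNReal.one_ne_top h

end State

/-! ### The form bound and the final estimate. -/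

theorem norm_inner_offDiag_le {P Q Q' : H →L[ℂ] H} (hP : 0 ≤ P) (hQ : IsStarProjection Q)
    (hQ' : IsStarProjection Q') (x y : H) :
    ‖⟪x, (Q * P * Q') y⟫_ℂ‖ ≤ ‖CFC.sqrt (Q * P * Q) x‖ * ‖CFC.sqrt (Q' * P * Q') y‖ := by
  rw [norm_sqrt_apply_compression hP hQ, norm_sqrt_apply_compression hP hQ']
  have h : (Q * P * Q') y = Q (CFC.sqrt P (CFC.sqrt P (Q' y))) := by
    conv_lhs => rw [← CFC.sqrt_mul_sqrt_self P hP]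
    rfl
  rw [h, ← inner_apply_of_isSelfAdjoint hQ.isSelfAdjoint,
    ← inner_apply_of_isSelfAdjoint (CFC.sqrt_nonneg P).isSelfAdjoint]
  exact norm_inner_le_norm _ _

/-- Writing `a = t r` and `d = u s`, this is `2√(rs) ≤ r + s` combined with `√t √u ≤ √W`. -/
theorem two_mul_sqrt_mul_sqrt_le {a d t u W : ℝ} (ha : 0 ≤ a) (hat : a ≤ t) (ht : t ≤ 1)
    (hd : 0 ≤ d) (hdu : d ≤ u) (hu : u ≤ W) :
    2 * √a * √d ≤ (a / t + d / u) * √W := by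
  have ht0 : 0 ≤ t := ha.trans hat
  have hu0 : 0 ≤ u := hd.trans hdu
  have hr : a = t * (a / t) := by
    rcases ht0.eq_or_lt with h | h
    -- A block of zero weight has `a = 0`, which agrees with the convention `a / 0 = 0`.
    · rw [← h] at hat ⊢; simp; linarith
    · field_simp
  have hs : d = u * (d / u) := by
    rcases hu0.eq_or_lt with h | h
    · rw [← h] at hdu ⊢; simp; linarith
    · field_simp
  have hr0 : 0 ≤ a / t := by positivity
  have hs0 : 0 ≤ d / u := by positivity
  generalize a / t = r at *
  generalize d / u = s at *
  subst hr hs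
  rw [Real.sqrt_mul ht0, Real.sqrt_mul hu0]
  have h1 : √t ≤ 1 := by rwa [Real.sqrt_le_one]
  have h2 : √u ≤ √W := Real.sqrt_le_sqrt hu
  have h3 : √t * √u ≤ √W := by
    nlinarith [Real.sqrt_nonneg t, Real.sqrt_nonneg u]
  have h4 : 2 * (√r * √s) ≤ r + s := by
    nlinarith [sq_nonneg (√r - √s), Real.sq_sqrt hr0, Real.sq_sqrt hs0]
  calc 2 * (√t * √r) * (√u * √s) = 2 * (√r * √s) * (√t * √u) := by ring
    _ ≤ (r + s) * √W := by gcongr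

end QTrace

end

theorem lemma3 {H : Type*} [NormedAddCommGroup H] [InnerProductSpace ℂ H] [CompleteSpace H]
    -- the measurement operator `P`, the projection `Q`, its complement `Q'`
    (P Q Q' : H →L[ℂ] H) (hP : QTrace.IsPOVMElement P) (hQ : IsStarProjection Q)
    (hQ' : Q' = 1 - Q)
    -- the blocks of `P` and its off-diagonal part
    (A B D offDiag : H →L[ℂ] H)
    (hA : A = Q * P * Q) (hB : B = Q * P * Q') (hD : D = Q' * P * Q')
    (hoffDiag : offDiag = B + star B)
    -- the state, its normalized diagonal blocks and the measurement probabilities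
    (ρ ρQ ρQ' : H →L[ℂ] H) (hρ : QTrace.IsState ρ)
    (hρQ : ρQ = (QTrace.trace (ρ * Q))⁻¹ • (Q * ρ * Q))
    (hρQ' : ρQ' = (QTrace.trace (ρ * Q'))⁻¹ • (Q' * ρ * Q'))
    (r s : ℝ) (hr : r = (QTrace.trace (ρQ * P)).re) (hs : s = (QTrace.trace (ρQ' * P)).re)
    (W : ℝ) (hW : (QTrace.trace (ρ * Q')).re ≤ W) :
    -- `√A^g B √D^g` is densely defined and bounded, the operator on the left is trace class,
    -- and the trace norm bound holds
    Dense ((QTrace.normalizedOffDiag A B D).domain : Set H) ∧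
      QTrace.opNorm (QTrace.normalizedOffDiag A B D) < ⊤ ∧
      QTrace.IsTraceClass (CFC.sqrt ρ * offDiag * CFC.sqrt ρ) ∧
      (QTrace.traceNorm (CFC.sqrt ρ * offDiag * CFC.sqrt ρ)).toReal ≤
        (r + s) * √W * (QTrace.opNorm (QTrace.normalizedOffDiag A B D)).toReal := by
  have hQ'p : IsStarProjection Q' := hQ' ▸ hQ.one_sub
  have hAD : ∀ x y, ‖⟪x, B y⟫_ℂ‖ ≤ ‖CFC.sqrt A x‖ * ‖CFC.sqrt D y‖ := fun x y => by
    rw [hA, hB, hD]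
    exact QTrace.norm_inner_offDiag_le hP.nonneg hQ hQ'p x y
  set k := (QTrace.opNorm (QTrace.normalizedOffDiag A B D)).toReal with hk
  have hk0 : 0 ≤ k := ENNReal.toReal_nonneg
  set R := CFC.sqrt ρ with hRdef
  have hR : IsSelfAdjoint R := (CFC.sqrt_nonneg ρ).isSelfAdjoint
  have hform : ∀ x y, ‖⟪x, (R * offDiag * R) y⟫_ℂ‖ ≤
      k * (‖(CFC.sqrt A * R) x‖ * ‖(CFC.sqrt D * R) y‖ +
        ‖(CFC.sqrt D * R) x‖ * ‖(CFC.sqrt A * R) y‖) := fun x y => by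
    have h1 : (R * offDiag * R) y = R (B (R y) + star B (R y)) := by rw [hoffDiag]; rfl
    have h2 : ‖⟪R x, star B (R y)⟫_ℂ‖ = ‖⟪R y, B (R x)⟫_ℂ‖ := by
      -- Conjugation exchanges `x` and `y`, so the adjoint block obeys the same bound with the roles
      -- of `A` and `D` swapped.
      rw [← inner_conj_symm, RCLike.norm_conj, QTrace.inner_star_apply_left]
    rw [h1, ← QTrace.inner_apply_of_isSelfAdjoint hR, inner_add_right]
    refine (norm_add_le _ _).trans ?_
    rw [h2, mul_add]
    refine add_le_add (QTrace.norm_inner_le_opNorm_normalizedOffDiag_mul hAD _ _)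
      ((QTrace.norm_inner_le_opNorm_normalizedOffDiag_mul hAD _ _).trans_eq ?_)
    rw [mul_comm ‖CFC.sqrt A (R y)‖]
    rfl
  have hsa : IsSelfAdjoint (R * offDiag * R) := by
    have h1 : IsSelfAdjoint offDiag := hoffDiag ▸ IsSelfAdjoint.add_star_self B
    simpa [hR.star_eq] using h1.conjugate R
  have hbound := QTrace.traceNorm_le_of_norm_inner_le hsa
    (hρ.hilbertSchmidtSq_mul_sqrt_lt_top _) (hρ.hilbertSchmidtSq_mul_sqrt_lt_top _) hk0 hform
  refine ⟨QTrace.dense_domain_normalizedOffDiag hAD,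
    (QTrace.opNorm_normalizedOffDiag_le_one hAD).trans_lt ENNReal.one_lt_top,
    hbound.trans_lt ENNReal.ofReal_lt_top, ?_⟩
  refine (ENNReal.toReal_le_of_le_ofReal (by positivity) hbound).trans ?_
  rw [hρ.trace_mul_isStarProjection hQ'p, Complex.ofReal_re] at hW
  rw [hρQ, hρ.trace_normalized_compression_mul hP.nonneg hQ] at hr
  rw [hρQ', hρ.trace_normalized_compression_mul hP.nonneg hQ'p] at hs
  rw [hr, hs, hA, hD]
  have h := QTrace.two_mul_sqrt_mul_sqrt_le ENNReal.toReal_nonneg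
    (hρ.hilbertSchmidtSq_sqrt_compression_le hP hQ)
    (hρ.hilbertSchmidtSq_isStarProjection_mul_le_one hQ) ENNReal.toReal_nonneg
    (hρ.hilbertSchmidtSq_sqrt_compression_le hP hQ'p) hW
  exact (le_of_eq (by ring)).trans (mul_le_mul_of_nonneg_right h hk0)
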